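/- \textbf{Setting.} Let $S$ (states) and $A$ (actions) be subsets of complete separable metric spaces with their Borel $\sigma$-algebras, let $K\subseteq S\times A$ be closed with sections $A(s)=\{a:(s,a)\in K\}$, let $Q(\cdot\mid s,a)$, $(s,a)\in K$, be a stochastic kernel from $K$ to $S$, and let $r,z:K\to\mathbb{R}$ be measurable. Write $(x)_-=\min\{x,0\}$. Let $Y$ be a real random variable with values a.s. in a compact interval $[a,b]$, and put $y(\eta)=\mathbb{E}[(Y-\eta)_-]$. For a history-dependent randomized policy $\pi$ which only uses actions in $A(s_t)$ and an initial distribution $\nu$ on $S$, let $\mathbb{E}_\nu^\pi$ be the expectation for the resulting process $(s_t,a_t)_{t\ge 0}$ in $K$, and let \[ R(\pi,\nu)=\liminf_{T\to\infty}\frac1T\,\mathbb{E}_\nu^\pi\Big[\sum_{t=0}^{T-1}r(s_t,a_t)\Big],\qquad Z_\eta(\pi,\nu)=\liminf_{T\to\infty}\frac1T\,\mathbb{E}_\nu^\pi\Big[\sum_{t=0}^{T-1}(z(s_t,a_t)-\eta)_-\Big]. \] Put $w=1-r$ on $K$ and $\hat w(s)=1-\sup_{a\in A(s)}r(s,a)$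 on $S$. For a weight $v\geq 1$ on $X$, let $\mathcal{F}_v(X)$ be the space of measurable $h:X\to\mathbb{R}$ with $\|h\|_v=\sup_{x}|h(x)|/v(x)<\infty$, and let $\mathcal{M}_v(X)$ be the space of signed measures $\mu$ on $X$ with $\int v\,d|\mu|<\infty$. Let $\mathcal{M}([a,b])$ be the space of finite signed Borel measures on $[a,b]$, with the weak* topology induced by $\mathcal{C}([a,b])$. \textbf{Standing assumptions.} (i) There is a pair $(\pi,\nu)$ with $R(\pi,\nu)>-\infty$ and $Z_\eta(\pi,\nu)\ge y(\eta)$ for all $\eta\in[a,b]$. (ii) $r\le 0$, and $\{(s,a)\in K:r(s,a)\ge-\epsilon\}$ is compact for every $\epsilon\ge 0$. (iii) $z$ is bounded and upper semicontinuous. (iv) $Q$ is weakly continuous: $(s,a)\mapsto\int f(\xi)\,Q(d\xi\mid s,a)$ is continuous on $K$ for every bounded continuous $f:S\to\mathbb{R}$. (v) $(z-\eta)_-\in\mathcal{F}_w(K)$ for all $\eta\in[a,b]$, and $(s,a)\mapsto\int\hat w(\xi)\,Q(d\xi\mid s,a)$ is (finite and) an element of $\mathcal{F}_w(K)$. \textbf{Primal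 problem} (LP): maximize $\int_K r\,d\mu$ over $\mu\in\mathcal{M}_w(K)$, $\mu\ge0$, such that $\mu(K)=1$, \[ \mu\big((B\times A)\cap K\big)=\int_K Q(B\mid s,a)\,\mu(d(s,a))\ \text{ for all Borel } B\subseteq S, \qquad \int_K(z-\eta)_-\,d\mu\ge y(\eta)\ \text{ for all }\eta\in[a,b]. \] \textbf{Dual problem} (LP-dual): minimize $\beta-\int_{[a,b]}y\,d\Lambda$ over $(h,\beta,\Lambda)\in\mathcal{F}_{\hat w}(S)\times\mathbb{R}\times\mathcal{M}([a,b])$, $\Lambda\ge0$, such that for all $(s,a)\in K$ \[ r(s,a)+h(s)-\int_S h(\xi)\,Q(d\xi\mid s,a)-\beta+\int_{[a,b]}(z(s,a)-\eta)_-\,\Lambda(d\eta)\le 0 . \] \textbf{Theorem.} Under the standing assumptions, suppose that there is a minimizing sequence $(h^n,\beta^n,\Lambda^n)$ of (LP-dual), that is, a sequence of feasible triples whose objective values converge to the optimal value of (LP-dual), such that $\{\beta^n\}$ is bounded in $\mathbb{R}$, $\{h^n\}$ is bounded in $\mathcal{F}_{\hat w}(S)$, and $\{\Lambda^n\}$ is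 bounded in the weak* topology on $\mathcal{M}([a,b])$ (that is, $\sup_n|\int f\,d\Lambda^n|<\infty$ for every $f\in\mathcal{C}([a,b])$). Then strong duality holds between (LP) and (LP-dual): their optimal values are equal, and both problems attain their optimal value. -/

import Mathlib

open MeasureTheory ProbabilityTheory Filter Topology Set

noncomputable section

/-- `(x)₋ = min {x, 0}`. -/
def minZero (x : ℝ) : ℝ := min x 0

/-- The extended expectation `E[f⁺] - E[f⁻]` of a real function, with values in `[-∞, ∞]`. It is
only used for functions that are bounded from above. -/
def extExpectation {X : Type*} [MeasurableSpace X] (P : Measure X) (f : X → ℝ) : EReal :=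
  ((∫⁻ x, ENNReal.ofReal (f x) ∂P : ENNReal) : EReal)
    - ((∫⁻ x, ENNReal.ofReal (-f x) ∂P : ENNReal) : EReal)

/-- The weighted norm `sup_x |h x| / w x`. -/
def weightedNorm {X : Type*} (w h : X → ℝ) : ℝ := ⨆ x, |h x| / w x

/-- The space `F_w(X)` of measurable functions of finite weighted norm. -/
def weightedFunctions {X : Type*} [MeasurableSpace X] (w : X → ℝ) : Set (X → ℝ) :=
  {h | Measurable h ∧ BddAbove (range fun x => |h x| / w x)}

/-- The nonnegative elements of the space `M_w(X)`: measures `μ` with `∫ w dμ < ∞`. -/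
def weightedMeasures {X : Type*} [MeasurableSpace X] (w : X → ℝ) : Set (Measure X) :=
  {μ | ∫⁻ x, ENNReal.ofReal (w x) ∂μ < ⊤}

/-- A Markov decision process with state space `S` and action space `A`: the closed set `K` of
feasible state-action pairs, the transition law `Q`, the reward `r`, and a second reward `z`. -/
structure MDP (S A : Type*) [TopologicalSpace S] [MeasurableSpace S]
    [TopologicalSpace A] [MeasurableSpace A] where
  K : Set (S × A)
  isClosed_K : IsClosed K
  Q : Kernel K S
  isMarkov_Q : IsMarkovKernel Q
  r : K → ℝ
  measurable_r : Measurable r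
  z : K → ℝ
  measurable_z : Measurable z

attribute [instance] MDP.isMarkov_Q

namespace MDP

section Model

variable {S A : Type*} [TopologicalSpace S] [MeasurableSpace S]
  [TopologicalSpace A] [MeasurableSpace A]

/-- The set `A(s)` of feasible actions in state `s`. -/
def actions (M : MDP S A) (s : S) : Set A := {a | (s, a) ∈ M.K}

/-- Histories `((s_0, a_0), …, (s_{t-1}, a_{t-1}), s_t)` at time `t`. -/
abbrev Hist (M : MDP S A) (t : ℕ) : Type _ := (Fin t → M.K) × S

/-- History-dependent randomized policies that respect the constraints `K`. -/
structure Policy (M : MDP S A) where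
  kernel : (t : ℕ) → Kernel (M.Hist t) A
  isMarkov : ∀ t, IsMarkovKernel (kernel t)
  feasible : ∀ (t : ℕ) (h : M.Hist t), kernel t h (M.actions h.2) = 1

attribute [instance] Policy.isMarkov

/-- The weight `w = 1 - r` on `K`. -/
def w (M : MDP S A) (k : M.K) : ℝ := 1 - M.r k

/-- The weight `ŵ(s) = 1 - sup_{a ∈ A(s)} r(s, a)` on `S`. -/
def wHat (M : MDP S A) (s : S) : ℝ := 1 - ⨆ a : M.actions s, M.r ⟨(s, a.1), a.2⟩

/-- `[L₀ μ](B) = μ(B × A) - ∫ Q(B | s, a) μ(d(s, a))`, for a nonnegative measure `μ` on `K`. -/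
def L₀ (M : MDP S A) (μ : Measure M.K) (B : Set S) : ℝ :=
  (μ {k | k.1.1 ∈ B}).toReal - ∫ k, (M.Q k B).toReal ∂μ

/-- `[L₁ μ](η) = ⟨μ, (z - η)₋⟩`. -/
def L₁ (M : MDP S A) (μ : Measure M.K) (η : ℝ) : ℝ := ∫ k, minZero (M.z k - η) ∂μ

/-- `[L₀* h](s, a) = h(s) - ∫ h(ξ) Q(dξ | s, a)`. -/
def L₀adj (M : MDP S A) (h : S → ℝ) (k : M.K) : ℝ := h k.1.1 - ∫ ξ, h ξ ∂(M.Q k)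

/-- `[L₁* Λ](s, a) = ∫_{[a, b]} (z(s, a) - η)₋ Λ(dη)`. -/
def L₁adj (M : MDP S A) {a b : ℝ} (Λ : FiniteMeasure (Icc a b)) (k : M.K) : ℝ :=
  ∫ η, minZero (M.z k - (η : ℝ)) ∂(Λ : Measure (Icc a b))

/-- The feasible region of the primal linear program. -/
def primalFeasible (M : MDP S A) (a b : ℝ) (y : ℝ → ℝ) : Set (Measure M.K) :=
  {μ | μ ∈ weightedMeasures M.w ∧ (∀ B, MeasurableSet B → M.L₀ μ B = 0) ∧
    ∫ _, (1 : ℝ) ∂μ = 1 ∧ ∀ η ∈ Icc a b, y η ≤ M.L₁ μ η}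

/-- The objective `⟨μ, r⟩` of the primal linear program. -/
def primalObjective (M : MDP S A) (μ : Measure M.K) : ℝ := ∫ k, M.r k ∂μ

/-- The optimal value of the primal linear program. -/
def primalValue (M : MDP S A) (a b : ℝ) (y : ℝ → ℝ) : EReal :=
  ⨆ μ ∈ M.primalFeasible a b y, (M.primalObjective μ : EReal)

/-- The feasible region of the dual linear program: triples `(h, β, Λ)`. -/
def dualFeasible (M : MDP S A) (a b : ℝ) : Set ((S → ℝ) × ℝ × FiniteMeasure (Icc a b)) :=
  {d | d.1 ∈ weightedFunctions M.wHat ∧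
    ∀ k : M.K, M.r k + M.L₀adj d.1 k - d.2.1 + M.L₁adj d.2.2 k ≤ 0}

/-- The objective `β - ⟨Λ, y⟩` of the dual linear program. -/
def dualObjective {a b : ℝ} (y : ℝ → ℝ) (d : (S → ℝ) × ℝ × FiniteMeasure (Icc a b)) : ℝ :=
  d.2.1 - ∫ η, y (η : ℝ) ∂(d.2.2 : Measure (Icc a b))

/-- The optimal value of the dual linear program. -/
def dualValue (M : MDP S A) (a b : ℝ) (y : ℝ → ℝ) : EReal :=
  ⨅ d ∈ M.dualFeasible a b, (dualObjective y d : EReal)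

end Model

section Dynamics

variable {S A : Type*}
  [TopologicalSpace S] [SecondCountableTopology S] [MeasurableSpace S] [BorelSpace S]
  [TopologicalSpace A] [SecondCountableTopology A] [MeasurableSpace A] [BorelSpace A]

/-- Given a history at time `t`, with current state `s`, the law of the pair `(s, a)` where the
action `a` is drawn from `π_t(· | history)`, as a probability measure on `K`. -/
def pairKernel (M : MDP S A) (π : M.Policy) (t : ℕ) : Kernel (M.Hist t) M.K :=
  ((Kernel.deterministic Prod.snd measurable_snd) ×ₖ (π.kernel t)).comapRight
    (MeasurableEmbedding.subtype_coe M.isClosed_K.measurableSet)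

instance (M : MDP S A) (π : M.Policy) (t : ℕ) : IsMarkovKernel (M.pairKernel π t) := by
  have hK : MeasurableSet {x : S × A | x ∈ M.K} := M.isClosed_K.measurableSet
  refine Kernel.IsMarkovKernel.comapRight _ _ fun h => ?_
  rw [Subtype.range_coe_subtype, Kernel.prod_apply, Kernel.deterministic_apply,
    Measure.prod_apply hK, lintegral_dirac' _ (measurable_measure_prodMk_left hK)]
  exact π.feasible t h

/-- The law of the history at time `t + 1` given the state-action pairs at times `0, …, t`: the
new state is drawn from `Q(· | s_t, a_t)`. -/
def histKernel (M : MDP S A) (t : ℕ) : Kernel (Finset.Iic t → M.K) (M.Hist (t + 1)) :=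
  (Kernel.deterministic
      (fun (x : Finset.Iic t → M.K) (i : Fin (t + 1)) =>
        x ⟨i, Finset.mem_Iic.2 (Nat.lt_succ_iff.1 i.2)⟩) (by fun_prop)) ×ₖ
    (M.Q.comap (fun x : Finset.Iic t → M.K => x ⟨t, Finset.mem_Iic.2 le_rfl⟩) (by fun_prop))

instance (M : MDP S A) (t : ℕ) : IsMarkovKernel (M.histKernel t) := by
  unfold histKernel
  infer_instance

/-- The law `P_ν^π` of the process `(s_t, a_t)`, `t ≥ 0`, on the space of its trajectories. -/
def pathMeasure (M : MDP S A) (π : M.Policy) (ν : ProbabilityMeasure S) : Measure (ℕ → M.K) :=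
  Kernel.trajMeasure (X := fun _ => M.K)
    (((ν : Measure S).map fun s => ((Fin.elim0, s) : M.Hist 0)).bind (M.pairKernel π 0))
    (fun t => (M.pairKernel π (t + 1)) ∘ₖ (M.histKernel t))

/-- The long-run expected average `liminf_T (1/T) E_ν^π [∑_{t < T} f(s_t, a_t)]`. -/
def longRunAverage (M : MDP S A) (f : M.K → ℝ) (π : M.Policy) (ν : ProbabilityMeasure S) :
    EReal :=
  liminf (fun T : ℕ => (((T : ℝ)⁻¹ : ℝ) : EReal) *
    extExpectation (M.pathMeasure π ν) (fun x => ∑ t ∈ Finset.range T, f (x t))) atTop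

/-- The set `Δ` of pairs `(π, ν)` with `R(π, ν) > -∞` and `Z_η(π, ν) ≥ y(η)` for `η ∈ [a, b]`. -/
def dominanceFeasible (M : MDP S A) (a b : ℝ) (y : ℝ → ℝ) :
    Set (M.Policy × ProbabilityMeasure S) :=
  {p | ⊥ < M.longRunAverage M.r p.1 p.2 ∧
    ∀ η ∈ Icc a b, (y η : EReal) ≤ M.longRunAverage (fun k => minZero (M.z k - η)) p.1 p.2}

end Dynamics
end MDP

/-- The expected shortfall `η ↦ E[(Y - η)₋]` of the benchmark `Y`. -/
def benchmarkShortfall {Ω : Type*} [MeasurableSpace Ω] (P : Measure Ω) (Y : Ω → ℝ) (η : ℝ) : ℝ :=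
  ∫ ω, minZero (Y ω - η) ∂P

end

noncomputable section

/-! Dual attainment comes from the bounded sequence. Along a subsequence `β n` converges and `Λ n`
converges weakly, by compactness of the probability measures on `[a, b]`. The functions `h n` have
no such compactness, but none is needed: the constraint reads `h(s) ≤ ∫ h dQ + c`, and such an
inequality passes to the pointwise upper limit, with the integrable weight `ŵ` as dominating
function (`exists_measurable_limit_le_integral`).

Let `v` be the dual value. For bounded continuous `h` and `Λ ≥ 0` put `f = L₀* h + L₁* Λ - ⟨Λ, y⟩`.
If `f + r ≤ v - ε` held on all of `K`, then `(h, v - ε + ⟨Λ, y⟩, Λ)` would be dual feasible with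
objective `v - ε`, which is absurd. So every `f` in this convex cone satisfies `sup (f + r) ≥ v`. A
minimax argument handles finitely many `f` at once, and compactness of the sublevel sets of `-r`
(hence tightness) handles all of them: one probability measure `μ` has `∫ (f + r) dμ ≥ v` for every
`f` (`exists_probabilityMeasure_of_forall_cone`). Scaling `f` gives `∫ f dμ ≥ 0`, which is primal
feasibility, and `f = 0` gives `∫ r dμ ≥ v`. Weak duality closes the argument. -/

/-! ### Semicontinuity and compactness in the space of probability measures. -/

theorem lowerSemicontinuous_of_isCompact_sublevel {X : Type*} [TopologicalSpace X]
    [T2Space X] {ℓ : X → ℝ} (hℓ0 : 0 ≤ ℓ)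
    (hℓ : ∀ c : ℝ, 0 ≤ c → IsCompact {x | ℓ x ≤ c}) : LowerSemicontinuous ℓ := by
  refine lowerSemicontinuous_iff_isClosed_preimage.2 fun c => ?_
  rcases le_or_gt 0 c with hc | hc
  · exact (hℓ c hc).isClosed
  · convert isClosed_empty
    ext x
    simpa using hc.trans_le (hℓ0 x)

theorem integrable_of_measurable_of_abs_le {Z : Type*} [MeasurableSpace Z] {μ : Measure Z}
    [IsFiniteMeasure μ] {f : Z → ℝ} (hf : Measurable f) {B : ℝ} (hB : ∀ x, |f x| ≤ B) :
    Integrable f μ :=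
  Integrable.of_bound hf.aestronglyMeasurable B (Eventually.of_forall hB)

/-- Probability measures that integrate `ℓ`, with `∫ (f - ℓ) ≥ c`. -/
def integralSuperlevel {X : Type*} [MeasurableSpace X] (ℓ f : X → ℝ) (c : ℝ) : Set (ProbabilityMeasure X) :=
  {μ | Integrable ℓ (μ : Measure X) ∧ c ≤ ∫ x, (f x - ℓ x) ∂(μ : Measure X)}

/-- The integrand `B - f + ℓ` is nonnegative, so a single bound on its `lintegral` encodes both the
integrability of `ℓ` and the inequality. Semicontinuity results for nonnegative functions then
apply. -/
theorem integralSuperlevel_eq {X : Type*} [MeasurableSpace X] {ℓ f : X → ℝ} (hℓ0 : 0 ≤ ℓ)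
    (hℓ : Measurable ℓ) (hf : Measurable f) {B c : ℝ} (hB : ∀ x, |f x| ≤ B) (hc : c ≤ B) :
    integralSuperlevel ℓ f c = {μ : ProbabilityMeasure X |
      ∫⁻ x, ENNReal.ofReal (B - f x + ℓ x) ∂(μ : Measure X) ≤ ENNReal.ofReal (B - c)} := by
  have hBf : ∀ x, 0 ≤ B - f x := fun x => sub_nonneg.2 ((le_abs_self _).trans (hB x))
  have h0 : ∀ x, 0 ≤ B - f x + ℓ x := fun x => add_nonneg (hBf x) (hℓ0 x)
  have hm : Measurable fun x => B - f x + ℓ x := (measurable_const.sub hf).add hℓ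
  ext μ
  have hfi : Integrable f (μ : Measure X) := integrable_of_measurable_of_abs_le hf hB
  have key : Integrable ℓ (μ : Measure X) →
      ∫ x, (f x - ℓ x) ∂(μ : Measure X) = B - ∫ x, (B - f x + ℓ x) ∂(μ : Measure X) := by
    intro hi
    have h1 := integral_add ((integrable_const B).sub hfi) hi
    have h2 := integral_sub (integrable_const (μ := (μ : Measure X)) B) hfi
    simp only [Pi.sub_apply, integral_const, probReal_univ, one_smul] at h1 h2
    rw [integral_sub hfi hi, h1, h2]
    ring
  constructor
  · rintro ⟨hi, hle⟩
    have hgi : Integrable (fun x => B - f x + ℓ x) (μ : Measure X) :=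
      ((integrable_const B).sub hfi).add hi
    rw [mem_ofPred_eq, ← ofReal_integral_eq_lintegral_ofReal hgi (Eventually.of_forall h0)]
    rw [key hi] at hle
    exact ENNReal.ofReal_le_ofReal (by linarith)
  · intro hle
    have hgi : Integrable (fun x => B - f x + ℓ x) (μ : Measure X) := by
      refine ⟨hm.aestronglyMeasurable, ?_⟩
      rw [hasFiniteIntegral_iff_ofReal (Eventually.of_forall h0)]
      exact lt_of_le_of_lt hle ENNReal.ofReal_lt_top
    have hi : Integrable ℓ (μ : Measure X) := by
      refine (hgi.sub ((integrable_const B).sub hfi)).congr (Eventually.of_forall fun x => ?_)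
      simp
    refine ⟨hi, ?_⟩
    rw [mem_ofPred_eq, ← ofReal_integral_eq_lintegral_ofReal hgi (Eventually.of_forall h0),
      ENNReal.ofReal_le_ofReal_iff (sub_nonneg.2 hc)] at hle
    rw [key hi]
    linarith

section CompactSublevels

variable {X : Type*} [TopologicalSpace X] [TopologicalSpace.MetrizableSpace X]
  [MeasurableSpace X] [BorelSpace X]

/-- The integral of a nonnegative lower semicontinuous function is lower semicontinuous along
weakly convergent sequences of probability measures. -/
theorem LowerSemicontinuous.lintegral_le_liminf_of_tendsto {g : X → ℝ}
    (hg : LowerSemicontinuous g) (hg0 : 0 ≤ g) {μs : ℕ → ProbabilityMeasure X}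
    {μ : ProbabilityMeasure X} (hμ : Tendsto μs atTop (𝓝 μ)) :
    ∫⁻ x, ENNReal.ofReal (g x) ∂(μ : Measure X) ≤
      liminf (fun n => ∫⁻ x, ENNReal.ofReal (g x) ∂(μs n : Measure X)) atTop := by
  -- Layer cake: the sets `{t < g}` are open, so the portmanteau inequality holds for each `t`, and
  -- Fatou's lemma integrates it over `t`.
  simp_rw [lintegral_eq_lintegral_meas_lt _ (Eventually.of_forall hg0) hg.measurable.aemeasurable]
  calc ∫⁻ t in Ioi (0 : ℝ), (μ : Measure X) {a | t < g a}
      ≤ ∫⁻ t in Ioi (0 : ℝ), liminf (fun n => (μs n : Measure X) {a | t < g a}) atTop := by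
        refine lintegral_mono fun t => ?_
        exact ProbabilityMeasure.le_liminf_measure_open_of_tendsto hμ (hg.isOpen_preimage t)
    _ ≤ liminf (fun n => ∫⁻ t in Ioi (0 : ℝ), (μs n : Measure X) {a | t < g a}) atTop :=
        lintegral_liminf_le fun n => Antitone.measurable fun s t hst =>
          measure_mono fun ω hω => lt_of_le_of_lt hst hω

variable [SecondCountableTopology X]

theorem LowerSemicontinuous.isClosed_setOf_lintegral_le {g : X → ℝ}
    (hg : LowerSemicontinuous g) (hg0 : 0 ≤ g) (c : ENNReal) :
    IsClosed {μ : ProbabilityMeasure X | ∫⁻ x, ENNReal.ofReal (g x) ∂(μ : Measure X) ≤ c} := by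
  refine IsSeqClosed.isClosed fun μs μ hμs hμ => ?_
  refine (hg.lintegral_le_liminf_of_tendsto hg0 hμ).trans ?_
  exact liminf_le_of_le (by isBoundedDefault) fun b hb =>
    let ⟨n, hn⟩ := hb.exists
    hn.trans (hμs n)

/-- A bound on the integral of a function with compact sublevel sets cuts out a compact set of
probability measures. -/
theorem isCompact_setOf_lintegral_le {ℓ : X → ℝ} (hℓ0 : 0 ≤ ℓ)
    (hℓ : ∀ c : ℝ, 0 ≤ c → IsCompact {x | ℓ x ≤ c}) (C : NNReal) :
    IsCompact {μ : ProbabilityMeasure X | ∫⁻ x, ENNReal.ofReal (ℓ x) ∂(μ : Measure X) ≤ C} := by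
  have hlsc := lowerSemicontinuous_of_isCompact_sublevel hℓ0 hℓ
  have hu : Tendsto (fun n : ℕ => C / ((n : NNReal) + 1)) atTop (𝓝 0) := by
    have h := (tendsto_one_div_add_atTop_nhds_zero_nat (𝕜 := NNReal)).const_mul C
    simpa [div_eq_mul_inv] using h
  -- Tightness: by Markov's inequality the mass outside the compact set `{ℓ ≤ n + 1}` is at most `C
  -- / (n + 1)`.
  refine (isCompact_setOfPred_probabilityMeasure_mass_eq_compl_isCompact_le
    (K := fun n : ℕ => {x | ℓ x ≤ (n : ℝ) + 1}) hu (fun n => hℓ _ (by positivity))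
    (Or.inr fun m n hmn x hx => ?_)).of_isClosed_subset
    (hlsc.isClosed_setOf_lintegral_le hℓ0 _) fun μ hμ n => ?_
  · have : (m : ℝ) ≤ n := by exact_mod_cast hmn
    simp only [mem_ofPred_eq] at hx ⊢
    linarith
  · rw [← ENNReal.coe_le_coe, ProbabilityMeasure.ennreal_coeFn_eq_coeFn_toMeasure]
    have hpos : ENNReal.ofReal ((n : ℝ) + 1) ≠ 0 := by
      rw [Ne, ENNReal.ofReal_eq_zero, not_le]; positivity
    calc (μ : Measure X) {x | ℓ x ≤ (n : ℝ) + 1}ᶜ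
        ≤ (μ : Measure X) {x | ENNReal.ofReal ((n : ℝ) + 1) ≤ ENNReal.ofReal (ℓ x)} := by
          refine measure_mono fun x hx => ?_
          simp only [mem_compl_iff, mem_ofPred_eq, not_le] at hx
          exact ENNReal.ofReal_le_ofReal hx.le
      _ ≤ (∫⁻ x, ENNReal.ofReal (ℓ x) ∂(μ : Measure X)) / ENNReal.ofReal ((n : ℝ) + 1) :=
          meas_ge_le_lintegral_div hlsc.measurable.ennreal_ofReal.aemeasurable hpos
            ENNReal.ofReal_ne_top
      _ ≤ (C : ENNReal) / ENNReal.ofReal ((n : ℝ) + 1) := by gcongr; exact hμ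
      _ = ((C / ((n : NNReal) + 1) : NNReal) : ENNReal) := by
          rw [ENNReal.coe_div (by positivity), ENNReal.ofReal_add (by positivity) (by simp)]
          simp

theorem isClosed_integralSuperlevel {ℓ f : X → ℝ} (hℓ0 : 0 ≤ ℓ) (hℓ : LowerSemicontinuous ℓ)
    (hf : UpperSemicontinuous f) {B : ℝ} (hB : ∀ x, |f x| ≤ B) (c : ℝ) :
    IsClosed (integralSuperlevel ℓ f c) := by
  -- `integralSuperlevel_eq` needs a bound that is at least the level `c`.
  have hB' : ∀ x, |f x| ≤ max B c := fun x => (hB x).trans (le_max_left _ _)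
  rw [integralSuperlevel_eq hℓ0 hℓ.measurable hf.measurable hB' (le_max_right B c)]
  refine LowerSemicontinuous.isClosed_setOf_lintegral_le ?_ ?_ _
  · refine LowerSemicontinuous.add ?_ hℓ
    have h : Antitone fun t : ℝ => max B c - t := fun s t hst => sub_le_sub_left hst _
    exact (continuous_const.sub continuous_id).comp_upperSemicontinuous_antitone hf h
  · exact fun x => add_nonneg (sub_nonneg.2 ((le_abs_self _).trans (hB' x))) (hℓ0 x)

theorem isCompact_integralSuperlevel_zero {ℓ : X → ℝ} (hℓ0 : 0 ≤ ℓ)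
    (hℓ : ∀ c : ℝ, 0 ≤ c → IsCompact {x | ℓ x ≤ c}) (c : ℝ) :
    IsCompact (integralSuperlevel ℓ 0 c) := by
  have hlsc := lowerSemicontinuous_of_isCompact_sublevel hℓ0 hℓ
  rcases le_or_gt c 0 with hc | hc
  · rw [integralSuperlevel_eq hℓ0 hlsc.measurable measurable_zero (B := 0) (by simp) hc]
    simpa using! isCompact_setOf_lintegral_le hℓ0 hℓ (Real.toNNReal (-c))
  · convert isCompact_empty
    refine eq_empty_of_forall_notMem fun μ hμ => ?_
    have h1 : ∫ x, ((0 : X → ℝ) x - ℓ x) ∂(μ : Measure X) ≤ 0 :=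
      integral_nonpos fun x => by simpa using hℓ0 x
    linarith [hμ.2]

/-! ### Minimax and the theorem of the alternative. -/

/-- Finite-dimensional minimax: if every nonnegative combination of finitely many bounded functions
exceeds a level somewhere, a probability measure exceeds the level for all of them at once. -/
theorem exists_probabilityMeasure_forall_mem_integralSuperlevel {ι : Type*} [Fintype ι]
    {ℓ : X → ℝ} {f : ι → X → ℝ} (hf : ∀ i, Measurable (f i))
    (hB : ∀ i, ∃ B : ℝ, ∀ x, |f i x| ≤ B) {v : ℝ} {δ : ι → ℝ} (hδ : ∀ i, 0 < δ i)
    (hne : Nonempty X)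
    (H : ∀ p : ι → ℝ, (∀ i, 0 ≤ p i) → ∀ ε : ℝ, 0 < ε →
      ∃ x, v - ε < (∑ i, p i * f i x) - ℓ x) :
    ∃ μ : ProbabilityMeasure X, ∀ i, μ ∈ integralSuperlevel ℓ (f i) (v - δ i) := by
  classical
  have hint : ∀ (μ : ProbabilityMeasure X) i, Integrable (f i) (μ : Measure X) := fun μ i =>
    let ⟨B, hB⟩ := hB i
    integrable_of_measurable_of_abs_le (hf i) hB
  -- `T` collects the attainable payoff vectors, `O` the vectors above the required levels. If they
  -- were disjoint, a separating functional would supply weights `p` contradicting `H`.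
  let T : Set (ι → ℝ) := {y | ∃ μ : ProbabilityMeasure X, Integrable ℓ (μ : Measure X) ∧
    ∀ i, y i = ∫ x, (f i x - ℓ x) ∂(μ : Measure X)}
  let O : Set (ι → ℝ) := {y | ∀ i, v - δ i < y i}
  have hT : Convex ℝ T := by
    rintro y ⟨μ, hμ, hy⟩ y' ⟨μ', hμ', hy'⟩ s t hs ht hst
    have hprob : IsProbabilityMeasure
        (ENNReal.ofReal s • (μ : Measure X) + ENNReal.ofReal t • (μ' : Measure X)) := by
      constructor
      simp [← ENNReal.ofReal_add hs ht, hst]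
    refine ⟨⟨_, hprob⟩, ?_, fun i => ?_⟩
    · exact (hμ.smul_measure ENNReal.ofReal_ne_top).add_measure
        (hμ'.smul_measure ENNReal.ofReal_ne_top)
    · have h1 : Integrable (fun x => f i x - ℓ x) (ENNReal.ofReal s • (μ : Measure X)) :=
        ((hint μ i).sub hμ).smul_measure ENNReal.ofReal_ne_top
      have h2 : Integrable (fun x => f i x - ℓ x) (ENNReal.ofReal t • (μ' : Measure X)) :=
        ((hint μ' i).sub hμ').smul_measure ENNReal.ofReal_ne_top
      simp only [ProbabilityMeasure.coe_mk]
      rw [integral_add_measure h1 h2, integral_smul_measure, integral_smul_measure]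
      simp [ENNReal.toReal_ofReal hs, ENNReal.toReal_ofReal ht, hy i, hy' i]
  have hO : Convex ℝ O := by
    have : O = ⋂ i, {y : ι → ℝ | v - δ i < y i} := by ext; simp [O]
    rw [this]
    exact convex_iInter fun i => convex_halfSpace_gt (LinearMap.proj i).isLinear _
  have hOo : IsOpen O := by
    have : O = ⋂ i, {y : ι → ℝ | v - δ i < y i} := by ext; simp [O]
    rw [this]
    exact isOpen_iInter_of_finite fun i => isOpen_lt continuous_const (continuous_apply i)
  have hdirac : ∀ x : X, (fun i => f i x - ℓ x) ∈ T := fun x => by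
    refine ⟨⟨Measure.dirac x, inferInstance⟩, ?_, fun i => ?_⟩
    · exact integrable_dirac (by simp)
    · simp only [ProbabilityMeasure.coe_mk]
      rw [integral_dirac]
  suffices h : ¬ Disjoint O T by
    obtain ⟨y, hyO, μ, hμ, hy⟩ := not_disjoint_iff.1 h
    exact ⟨μ, fun i => ⟨hμ, (hy i) ▸ (hyO i).le⟩⟩
  intro hdisj
  obtain ⟨g, c, hgO, hgT⟩ := geometric_hahn_banach_open hO hOo hT hdisj
  let p : ι → ℝ := fun i => - g (Pi.single i 1)
  have hg : ∀ y : ι → ℝ, g y = - ∑ i, p i * y i := fun y => by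
    conv_lhs => rw [← Finset.univ_sum_single y]
    rw [map_sum, ← Finset.sum_neg_distrib]
    refine Finset.sum_congr rfl fun i _ => ?_
    have : (Pi.single i (y i) : ι → ℝ) = y i • Pi.single i (1 : ℝ) := by
      rw [← Pi.single_smul]; simp
    rw [this, map_smul]
    simp [p, mul_comm]
  let y₀ : ι → ℝ := fun i => v - δ i / 2
  have hy₀ : y₀ ∈ O := fun i => by have := hδ i; simp only [y₀]; linarith
  have hp : ∀ i, 0 ≤ p i := by
    intro i
    by_contra! hi
    -- `O` is closed under increasing a coordinate. If `p i < 0`, moving `y₀` this far along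
    -- coordinate `i` raises `g` to at least `c`.
    let t : ℝ := max 0 ((c - g y₀) / (- p i))
    have ht : y₀ + t • Pi.single i (1 : ℝ) ∈ O := by
      intro j
      have h1 := hy₀ j
      have h2 : 0 ≤ t * (Pi.single i (1 : ℝ) : ι → ℝ) j :=
        mul_nonneg (le_max_left _ _) (by rw [Pi.single_apply]; split_ifs <;> simp)
      simp only [Pi.add_apply, Pi.smul_apply, smul_eq_mul]
      linarith
    have h1 := hgO _ ht
    rw [map_add, map_smul] at h1
    have h2 : (c - g y₀) / (- p i) ≤ t := le_max_right _ _
    rw [div_le_iff₀ (by linarith)] at h2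
    simp only [smul_eq_mul, p, neg_neg] at h1 h2
    linarith
  obtain ⟨x₀⟩ := hne
  have hP : 0 < ∑ i, p i := by
    refine (Finset.sum_nonneg fun i _ => hp i).lt_of_ne' fun h0 => ?_
    have hp0 : ∀ i, p i = 0 := fun i =>
      (Finset.sum_eq_zero_iff_of_nonneg fun i _ => hp i).1 h0 i (Finset.mem_univ i)
    have h1 := hgO _ hy₀
    have h2 := hgT _ (hdirac x₀)
    simp only [hg, hp0, zero_mul, Finset.sum_const_zero] at h1 h2
    linarith
  set P := ∑ i, p i
  -- This `ε` is the weighted mean of the gaps `δ i / 2` between `v` and `y₀`; with it, `H` for the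
  -- normalized weights contradicts the separation of `y₀` from a Dirac payoff.
  have hε : 0 < (∑ i, p i * (δ i / 2)) / P := by
    obtain ⟨i, _, hi⟩ : ∃ i ∈ Finset.univ, 0 < p i := by
      by_contra! h
      exact hP.not_ge (Finset.sum_nonpos h)
    refine div_pos (Finset.sum_pos' (fun j _ => ?_) ⟨i, Finset.mem_univ i, ?_⟩) hP
    · exact mul_nonneg (hp j) (half_pos (hδ j)).le
    · exact mul_pos hi (half_pos (hδ i))
  obtain ⟨x, hx⟩ := H (fun i => p i / P) (fun i => div_nonneg (hp i) hP.le) _ hε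
  have h1 := hgO _ hy₀
  have h2 := hgT _ (hdirac x)
  rw [hg] at h1 h2
  have e1 : ∑ i, p i * y₀ i = P * v - ∑ i, p i * (δ i / 2) := by
    simp only [y₀, mul_sub, Finset.sum_sub_distrib, P, Finset.sum_mul]
  have e2 : ∑ i, p i * (f i x - ℓ x) = ∑ i, p i * f i x - P * ℓ x := by
    simp only [mul_sub, Finset.sum_sub_distrib, P, Finset.sum_mul]
  have e3 : ∑ i, p i / P * f i x = (∑ i, p i * f i x) / P := by
    rw [Finset.sum_div]
    exact Finset.sum_congr rfl fun i _ => by ring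
  rw [e3] at hx
  have h3 := mul_lt_mul_of_pos_left hx hP
  have e4 : P * (v - (∑ i, p i * (δ i / 2)) / P) = P * v - ∑ i, p i * (δ i / 2) := by
    field_simp
  have e5 : P * ((∑ i, p i * f i x) / P - ℓ x) = ∑ i, p i * f i x - P * ℓ x := by
    field_simp
  rw [e4, e5] at h3
  rw [e1] at h1
  rw [e2] at h2
  linarith

/-- Theorem of the alternative for a convex cone `F` of bounded upper semicontinuous functions and
a cost `ℓ` with compact sublevel sets. -/
theorem exists_probabilityMeasure_of_forall_cone {ℓ : X → ℝ} (hℓ0 : 0 ≤ ℓ)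
    (hℓ : ∀ c : ℝ, 0 ≤ c → IsCompact {x | ℓ x ≤ c}) {F : Set (X → ℝ)} (hF0 : (0 : X → ℝ) ∈ F)
    (hFadd : ∀ f ∈ F, ∀ g ∈ F, f + g ∈ F) (hFsmul : ∀ f ∈ F, ∀ c : ℝ, 0 ≤ c → c • f ∈ F)
    (hFusc : ∀ f ∈ F, UpperSemicontinuous f) (hFB : ∀ f ∈ F, ∃ B : ℝ, ∀ x, |f x| ≤ B) {v : ℝ}
    (H : ∀ f ∈ F, ∀ ε : ℝ, 0 < ε → ∃ x, v - ε < f x - ℓ x) :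
    ∃ μ : ProbabilityMeasure X, Integrable ℓ (μ : Measure X) ∧
      v ≤ -∫ x, ℓ x ∂(μ : Measure X) ∧ ∀ f ∈ F, 0 ≤ ∫ x, f x ∂(μ : Measure X) := by
  classical
  have hlsc := lowerSemicontinuous_of_isCompact_sublevel hℓ0 hℓ
  have hsum : ∀ {ι : Type _} (s : Finset ι) (f : ι → X → ℝ), (∀ i ∈ s, f i ∈ F) →
      ∑ i ∈ s, f i ∈ F := fun s f hf => Finset.sum_induction f (· ∈ F) (fun a b ha hb =>
        hFadd a ha b hb) hF0 hf
  obtain ⟨x₀, -⟩ := H 0 hF0 1 one_pos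
  let I := F × {δ : ℝ // 0 < δ}
  obtain ⟨μ, -, hμ⟩ := (isCompact_integralSuperlevel_zero hℓ0 hℓ (v - 1)).inter_iInter_nonempty
    (fun i : I => integralSuperlevel ℓ i.1 (v - i.2))
    (fun i => let ⟨B, hB⟩ := hFB i.1 i.1.2
      isClosed_integralSuperlevel hℓ0 hlsc (hFusc i.1 i.1.2) hB _)
    (fun u => by
      -- The index `(0, 1)` is added so that the measure also lies in the compact set
      -- `integralSuperlevel ℓ 0 (v - 1)`.
      let i₀ : I := (⟨0, hF0⟩, ⟨1, one_pos⟩)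
      let u' := insert i₀ u
      obtain ⟨μ, hμ⟩ := exists_probabilityMeasure_forall_mem_integralSuperlevel (ι := u')
        (f := fun i => i.1.1) (δ := fun i => i.1.2)
        (fun i => (hFusc _ i.1.1.2).measurable) (fun i => hFB _ i.1.1.2) (v := v)
        (fun i => i.1.2.2) ⟨x₀⟩ (fun p hp ε hε => by
          obtain ⟨x, hx⟩ := H (∑ i : u', p i • (i.1.1 : X → ℝ))
            (hsum _ _ fun i _ => hFsmul _ i.1.1.2 _ (hp i)) ε hε
          exact ⟨x, by simpa using hx⟩)
      refine ⟨μ, hμ ⟨i₀, Finset.mem_insert_self _ _⟩, mem_iInter₂.2 fun i hi => ?_⟩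
      exact hμ ⟨i, Finset.mem_insert_of_mem hi⟩)
  rw [mem_iInter] at hμ
  have hi : Integrable ℓ (μ : Measure X) := (hμ (⟨0, hF0⟩, ⟨1, one_pos⟩)).1
  have hv : ∀ f ∈ F, v ≤ ∫ x, f x ∂(μ : Measure X) - ∫ x, ℓ x ∂(μ : Measure X) := by
    intro f hf
    obtain ⟨B, hB⟩ := hFB f hf
    rw [← integral_sub (integrable_of_measurable_of_abs_le (hFusc f hf).measurable hB) hi]
    refine le_of_forall_sub_le fun δ hδ => (hμ (⟨f, hf⟩, ⟨δ, hδ⟩)).2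
  refine ⟨μ, hi, by simpa using hv 0 hF0, fun f hf => ?_⟩
  by_contra! hneg
  set J := ∫ x, f x ∂(μ : Measure X)
  set L := ∫ x, ℓ x ∂(μ : Measure X)
  -- The factor rescales the negative integral `J` to `-(|v| + |L| + 1)`, too low for `hv`.
  have h1 := hv _ (hFsmul f hf ((|v| + |L| + 1) / (-J)) (by
    have : 0 < -J := by linarith
    positivity))
  simp only [Pi.smul_apply, smul_eq_mul, integral_const_mul] at h1
  have e : (|v| + |L| + 1) / (-J) * J = -(|v| + |L| + 1) := by
    rw [div_neg, neg_mul, div_mul_cancel₀ _ hneg.ne]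
  change v ≤ (|v| + |L| + 1) / (-J) * J - L at h1
  rw [e] at h1
  linarith [neg_abs_le v, neg_abs_le L]

end CompactSublevels

/-! ### Continuity of the benchmark shortfall. -/

theorem continuous_minZero : Continuous minZero := continuous_id.min continuous_const

theorem monotone_minZero : Monotone minZero := fun _ _ h => min_le_min_right 0 h

theorem abs_minZero_sub_le (x y : ℝ) : |minZero x - minZero y| ≤ |x - y| := by
  simpa [minZero] using abs_min_sub_min_le_max x 0 y 0

theorem continuous_benchmarkShortfall {Ω : Type*} [MeasurableSpace Ω] {P : Measure Ω}
    [IsProbabilityMeasure P] {a b : ℝ} {Y : Ω → ℝ} (hY : Measurable Y)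
    (hYab : ∀ᵐ ω ∂P, Y ω ∈ Icc a b) : Continuous (benchmarkShortfall P Y) := by
  have hYi : Integrable Y P := by
    refine Integrable.of_bound hY.aestronglyMeasurable (max |a| |b|) ?_
    filter_upwards [hYab] with ω hω
    exact abs_le_max_abs_abs hω.1 hω.2
  have hi : ∀ η, Integrable (fun ω => minZero (Y ω - η)) P := fun η => by
    refine (hYi.sub (integrable_const η)).mono
      (continuous_minZero.measurable.comp (hY.sub_const η)).aestronglyMeasurable
      (Eventually.of_forall fun ω => ?_)
    simpa [minZero] using abs_minZero_sub_le (Y ω - η) 0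
  refine (LipschitzWith.of_dist_le_mul (K := 1) fun η η' => ?_).continuous
  rw [Real.dist_eq, Real.dist_eq, benchmarkShortfall, benchmarkShortfall,
    ← integral_sub (hi η) (hi η')]
  have h := norm_integral_le_of_norm_le_const (μ := P)
    (f := fun ω => minZero (Y ω - η) - minZero (Y ω - η')) (C := |η - η'|)
    (Eventually.of_forall fun ω => by
      refine (abs_minZero_sub_le _ _).trans_eq ?_
      rw [sub_sub_sub_cancel_left, abs_sub_comm])
  simpa using h

/-! ### Limits of dual variables. -/

/-- A pointwise upper bound `h n (σ k) ≤ ∫ h n dκ(k) + c n k` passes to the upper limit of a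
sequence `h n` that is dominated by a `κ`-integrable weight. -/
theorem exists_measurable_limit_le_integral {S X : Type*} [MeasurableSpace S] [MeasurableSpace X]
    (κ : Kernel X S) (σ : X → S) {W : S → ℝ} (hW : ∀ k, Integrable W (κ k)) {h : ℕ → S → ℝ}
    (hm : ∀ n, Measurable (h n)) (hhW : ∀ n s, |h n s| ≤ W s) {c : ℕ → X → ℝ} {c' : X → ℝ}
    (hc : ∀ k, Tendsto (fun n => c n k) atTop (𝓝 (c' k)))
    (hle : ∀ n k, h n (σ k) ≤ ∫ ξ, h n ξ ∂(κ k) + c n k) :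
    ∃ h' : S → ℝ, Measurable h' ∧ (∀ s, |h' s| ≤ W s) ∧
      ∀ k, h' (σ k) ≤ ∫ ξ, h' ξ ∂(κ k) + c' k := by
  -- Tail suprema decrease to the upper limit, and `h m ≤ H n` for `m ≥ n` enlarges only the
  -- right-hand side; dominated convergence is then needed for `H` alone.
  let H : ℕ → S → ℝ := fun n s => ⨆ m, h (n + m) s
  have hbdd : ∀ n s, BddAbove (range fun m => h (n + m) s) := fun n s =>
    ⟨W s, by rintro _ ⟨m, rfl⟩; exact (abs_le.1 (hhW _ s)).2⟩
  have hHm : ∀ n, Measurable (H n) := fun n => Measurable.iSup fun m => hm (n + m)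
  have hhH : ∀ n m s, n ≤ m → h m s ≤ H n s := fun n m s hnm => by
    obtain ⟨j, rfl⟩ := Nat.exists_eq_add_of_le hnm
    exact le_ciSup (hbdd n s) j
  have hHW : ∀ n s, |H n s| ≤ W s := fun n s => abs_le.2
    ⟨(abs_le.1 (hhW n s)).1.trans (hhH n n s le_rfl), ciSup_le fun m => (abs_le.1 (hhW _ s)).2⟩
  have hHanti : ∀ s, Antitone fun n => H n s := fun s n m hnm =>
    ciSup_le fun j => hhH n (m + j) s (hnm.trans (Nat.le_add_right _ _))
  have hHb : ∀ s, BddBelow (range fun n => H n s) := fun s =>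
    ⟨-W s, by rintro _ ⟨n, rfl⟩; exact (abs_le.1 (hHW n s)).1⟩
  have hlim : ∀ s, Tendsto (fun n => H n s) atTop (𝓝 (⨅ n, H n s)) := fun s =>
    tendsto_atTop_ciInf (hHanti s) (hHb s)
  have hHi : ∀ n k, Integrable (H n) (κ k) := fun n k =>
    (hW k).mono' (hHm n).aestronglyMeasurable (Eventually.of_forall (hHW n))
  have hhi : ∀ n k, Integrable (h n) (κ k) := fun n k =>
    (hW k).mono' (hm n).aestronglyMeasurable (Eventually.of_forall (hhW n))
  refine ⟨fun s => ⨅ n, H n s, Measurable.iInf hHm, fun s => ?_, fun k => ?_⟩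
  · exact le_of_tendsto (hlim s).abs (Eventually.of_forall fun n => hHW n s)
  · have hint : Tendsto (fun n => ∫ ξ, H n ξ ∂(κ k)) atTop (𝓝 (∫ ξ, ⨅ n, H n ξ ∂(κ k))) :=
      tendsto_integral_of_dominated_convergence W (fun n => (hHm n).aestronglyMeasurable) (hW k)
        (fun n => Eventually.of_forall (hHW n)) (Eventually.of_forall hlim)
    refine ge_of_tendsto (hint.add_const (c' k)) (Eventually.of_forall fun n => ?_)
    refine le_of_forall_pos_le_add fun ε hε => ?_
    obtain ⟨N, hN⟩ := eventually_atTop.1 ((hc k).eventually_lt_const (lt_add_of_pos_right _ hε))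
    -- Beyond `max n N` both estimates are available: `h ≤ H n` and `c < c' + ε`.
    refine (ciInf_le (hHb _) (max n N)).trans (ciSup_le fun m => ?_)
    have h1 := hle (max n N + m) k
    have h2 := hN (max n N + m) ((le_max_right n N).trans (Nat.le_add_right _ _))
    have h3 : ∫ ξ, h (max n N + m) ξ ∂(κ k) ≤ ∫ ξ, H n ξ ∂(κ k) :=
      integral_mono (hhi _ k) (hHi n k) fun ξ =>
        hhH n _ ξ ((le_max_left n N).trans (Nat.le_add_right _ _))
    linarith

section Shortfall

variable {a b : ℝ}

/-- The function `t ↦ ∫ (t - η)₋ Λ(dη)`. -/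
def shortfallIntegral (Λ : FiniteMeasure (Icc a b)) (t : ℝ) : ℝ :=
  ∫ η, minZero (t - (η : ℝ)) ∂(Λ : Measure (Icc a b))

theorem Continuous.integrable_of_isFiniteMeasure {Z : Type*} [TopologicalSpace Z] [CompactSpace Z]
    [MeasurableSpace Z] [OpensMeasurableSpace Z] {μ : Measure Z} [IsFiniteMeasure μ] {f : Z → ℝ}
    (hf : Continuous f) : Integrable f μ :=
  (BoundedContinuousFunction.mkOfCompact ⟨f, hf⟩).integrable μ

theorem integrable_minZero_sub (Λ : FiniteMeasure (Icc a b)) (t : ℝ) :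
    Integrable (fun η : Icc a b => minZero (t - (η : ℝ))) (Λ : Measure (Icc a b)) :=
  Continuous.integrable_of_isFiniteMeasure
    (continuous_minZero.comp (continuous_const.sub continuous_subtype_val))

theorem monotone_shortfallIntegral (Λ : FiniteMeasure (Icc a b)) :
    Monotone (shortfallIntegral Λ) := fun _ _ h =>
  integral_mono (integrable_minZero_sub Λ _) (integrable_minZero_sub Λ _) fun _ =>
    monotone_minZero (sub_le_sub_right h _)

theorem continuous_shortfallIntegral (Λ : FiniteMeasure (Icc a b)) :
    Continuous (shortfallIntegral Λ) := by
  have h := continuous_parametric_integral_of_continuous (μ := (Λ : Measure (Icc a b)))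
    (f := fun (t : ℝ) (η : Icc a b) => minZero (t - (η : ℝ)))
    (continuous_minZero.comp (by fun_prop)) isCompact_univ
  simp only [Measure.restrict_univ] at h
  exact h

theorem exists_abs_shortfallIntegral_le (Λ : FiniteMeasure (Icc a b)) (C : ℝ) :
    ∃ B, ∀ t, |t| ≤ C → |shortfallIntegral Λ t| ≤ B := by
  obtain ⟨B, hB⟩ := (isCompact_Icc (a := -C) (b := C)).exists_bound_of_continuousOn
    (continuous_shortfallIntegral Λ).continuousOn
  exact ⟨B, fun t ht => hB t (abs_le.1 ht)⟩

/-- A sequence of finite measures on a compact interval with bounded masses has a subsequence along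
which the integrals of all continuous functions converge. -/
theorem exists_subseq_tendsto_integral {Z : Type*} [TopologicalSpace Z] [CompactSpace Z]
    [TopologicalSpace.MetrizableSpace Z] [MeasurableSpace Z] [BorelSpace Z] [Nonempty Z]
    (Λ : ℕ → FiniteMeasure Z) {C : ℝ} (hC : ∀ n, ((Λ n).mass : ℝ) ≤ C)
    (β : ℕ → ℝ) {C' : ℝ} (hC' : ∀ n, |β n| ≤ C') :
    ∃ (Λ' : FiniteMeasure Z) (β' : ℝ) (φ : ℕ → ℕ), StrictMono φ ∧
      Tendsto (β ∘ φ) atTop (𝓝 β') ∧ ∀ f : Z → ℝ, Continuous f →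
        Tendsto (fun n => ∫ z, f z ∂(Λ (φ n) : Measure Z)) atTop
          (𝓝 (∫ z, f z ∂(Λ' : Measure Z))) := by
  -- Splitting off the mass allows the compactness of the probability measures on `Z` to be used. A
  -- zero measure has an arbitrary normalization, which its mass cancels.
  let u : ℕ → ProbabilityMeasure Z × ℝ × ℝ := fun n => ((Λ n).normalize, ((Λ n).mass : ℝ), β n)
  have hu : ∀ n, u n ∈ (univ : Set (ProbabilityMeasure Z)) ×ˢ (Icc 0 C ×ˢ Icc (-C') C') :=
    fun n => ⟨mem_univ _, ⟨(Λ n).mass.coe_nonneg, hC n⟩, abs_le.1 (hC' n)⟩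
  obtain ⟨⟨P, m, β'⟩, ⟨-, hm, -⟩, φ, hφ, hlim⟩ :=
    (isCompact_univ.prod (isCompact_Icc.prod isCompact_Icc)).tendsto_subseq hu
  rw [nhds_prod_eq, nhds_prod_eq] at hlim
  have hP : Tendsto (fun n => (Λ (φ n)).normalize) atTop (𝓝 P) := hlim.fst
  have hmass : Tendsto (fun n => ((Λ (φ n)).mass : ℝ)) atTop (𝓝 m) := hlim.snd.fst
  refine ⟨Real.toNNReal m • P.toFiniteMeasure, β', φ, hφ, hlim.snd.snd, fun f hf => ?_⟩
  have h1 := ProbabilityMeasure.tendsto_iff_forall_integral_tendsto.1 hP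
    (BoundedContinuousFunction.mkOfCompact ⟨f, hf⟩)
  have h2 := hmass.mul h1
  have e : ∀ (c : NNReal) (Q : ProbabilityMeasure Z),
      ∫ z, f z ∂((c • Q.toFiniteMeasure : FiniteMeasure Z) : Measure Z) =
        c * ∫ z, f z ∂(Q : Measure Z) := fun c Q => by
    rw [FiniteMeasure.toMeasure_smul, integral_smul_nnreal_measure]
    rfl
  rw [e, Real.coe_toNNReal _ hm.1]
  refine h2.congr fun n => ?_
  conv_rhs => rw [(Λ (φ n)).self_eq_mass_smul_normalize]
  exact (e _ _).symm

end Shortfall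

/-! ### Weighted functions, invariant measures and weak duality. -/

theorem abs_le_weightedNorm_mul {X : Type*} [MeasurableSpace X] {w h : X → ℝ}
    (hw : ∀ x, 0 < w x) (hh : h ∈ weightedFunctions w) (x : X) :
    |h x| ≤ weightedNorm w h * w x :=
  (div_le_iff₀ (hw x)).1 (le_ciSup hh.2 x)

theorem mem_weightedFunctions_of_abs_le {X : Type*} [MeasurableSpace X] {w h : X → ℝ}
    (hw : ∀ x, 0 < w x) (hm : Measurable h) {C : ℝ} (hC : ∀ x, |h x| ≤ C * w x) :
    h ∈ weightedFunctions w :=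
  ⟨hm, C, by rintro _ ⟨x, rfl⟩; exact (div_le_iff₀ (hw x)).2 (hC x)⟩

theorem integral_bind_kernel {S X : Type*} [MeasurableSpace S]
    [MeasurableSpace X] {μ : Measure X} [SFinite μ]
    {κ : Kernel X S} [IsSFiniteKernel κ] {h : S → ℝ} (hi : Integrable h (μ.bind κ)) :
    ∫ s, h s ∂(μ.bind κ) = ∫ x, ∫ s, h s ∂(κ x) ∂μ := by
  rw [← Measure.snd_compProd] at hi ⊢
  rw [Measure.snd, integral_map measurable_snd.aemeasurable hi.aestronglyMeasurable,
    Measure.integral_compProd]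
  exact hi.comp_measurable measurable_snd

namespace MDP

section Duality

variable {S A : Type*} [TopologicalSpace S] [MeasurableSpace S]
  [TopologicalSpace A] [MeasurableSpace A] {M : MDP S A}

theorem one_le_wHat (hr : ∀ k, M.r k ≤ 0) (s : S) : 1 ≤ M.wHat s := by
  -- If `A(s)` is empty, the real supremum takes the default value `0`, so the bound still holds.
  have : ⨆ a : M.actions s, M.r ⟨(s, a.1), a.2⟩ ≤ 0 := Real.iSup_nonpos fun a => hr _
  unfold wHat
  linarith

/-- Through this comparison a measure integrating `w` also integrates `h(s)` for every `h` in
`F_ŵ(S)`. -/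
theorem wHat_le_w (hr : ∀ k, M.r k ≤ 0) (k : M.K) : M.wHat k.1.1 ≤ M.w k := by
  have : M.r k ≤ ⨆ a : M.actions k.1.1, M.r ⟨(k.1.1, a.1), a.2⟩ :=
    le_ciSup (f := fun a : M.actions k.1.1 => M.r ⟨(k.1.1, a.1), a.2⟩)
      ⟨0, by rintro _ ⟨a, rfl⟩; exact hr _⟩ ⟨k.1.2, k.2⟩
  unfold wHat w
  linarith

theorem one_le_w (hr : ∀ k, M.r k ≤ 0) (k : M.K) : 1 ≤ M.w k := by
  have := hr k
  unfold w
  linarith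

theorem measurable_w : Measurable M.w := measurable_const.sub M.measurable_r

theorem isProbabilityMeasure_of_mem_primalFeasible {a b : ℝ} {y : ℝ → ℝ} {μ : Measure M.K}
    (hμ : μ ∈ M.primalFeasible a b y) : IsProbabilityMeasure μ := by
  have h := hμ.2.2.1
  rw [integral_const, smul_eq_mul, mul_one, measureReal_def] at h
  exact ⟨by rw [← ENNReal.toReal_eq_one_iff]; exact h⟩

theorem integrable_w_of_mem_primalFeasible (hr : ∀ k, M.r k ≤ 0) {a b : ℝ} {y : ℝ → ℝ}
    {μ : Measure M.K} (hμ : μ ∈ M.primalFeasible a b y) : Integrable M.w μ := by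
  refine ⟨measurable_w.aestronglyMeasurable, ?_⟩
  rw [hasFiniteIntegral_iff_ofReal
    (Eventually.of_forall fun k => zero_le_one.trans (one_le_w hr k))]
  exact hμ.1

theorem map_eq_bind_of_forall_L₀ {μ : Measure M.K} [IsFiniteMeasure μ]
    (hμ : ∀ B, MeasurableSet B → M.L₀ μ B = 0) :
    μ.map (fun k : M.K => k.1.1) = μ.bind M.Q := by
  have hσ : Measurable fun k : M.K => k.1.1 := measurable_fst.comp measurable_subtype_coe
  ext B hB
  rw [Measure.map_apply hσ hB, Measure.bind_apply hB M.Q.aemeasurable]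
  have h := hμ B hB
  have hfin : ∫⁻ k, M.Q k B ∂μ ≠ ⊤ := by
    refine ((lintegral_mono (g := fun _ => 1) fun k => prob_le_one).trans_lt ?_).ne
    simp
  rw [L₀, integral_toReal (M.Q.measurable_coe hB).aemeasurable
    (Eventually.of_forall fun k => measure_lt_top _ _), sub_eq_zero] at h
  exact (ENNReal.toReal_eq_toReal_iff' (measure_ne_top _ _) hfin).1 h

theorem L₀_eq_zero_of_map_eq_bind {μ : Measure M.K} [IsFiniteMeasure μ]
    (hμ : μ.map (fun k : M.K => k.1.1) = μ.bind M.Q) {B : Set S} (hB : MeasurableSet B) :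
    M.L₀ μ B = 0 := by
  have hσ : Measurable fun k : M.K => k.1.1 := measurable_fst.comp measurable_subtype_coe
  rw [L₀, integral_toReal (M.Q.measurable_coe hB).aemeasurable
    (Eventually.of_forall fun k => measure_lt_top _ _), ← Measure.bind_apply hB M.Q.aemeasurable,
    ← hμ, Measure.map_apply hσ hB]
  exact sub_self _

/-- Both terms of `L₀adj h` integrate to the integral of `h` against one measure, the state marginal
of `μ`. -/
theorem integral_L₀adj_eq_zero {μ : Measure M.K} [IsFiniteMeasure μ]
    (hμ : μ.map (fun k : M.K => k.1.1) = μ.bind M.Q) {h : S → ℝ} (hm : Measurable h)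
    (hi : Integrable (fun k : M.K => h k.1.1) μ) :
    Integrable (M.L₀adj h) μ ∧ ∫ k, M.L₀adj h k ∂μ = 0 := by
  have hσ : Measurable fun k : M.K => k.1.1 := measurable_fst.comp measurable_subtype_coe
  have hi' : Integrable h (μ.bind M.Q) := by
    rw [← hμ, integrable_map_measure hm.aestronglyMeasurable hσ.aemeasurable]
    exact hi
  have hQi : Integrable (fun k => ∫ ξ, h ξ ∂(M.Q k)) μ := by
    rw [← Measure.snd_compProd] at hi'
    exact (hi'.comp_measurable measurable_snd).integral_compProd
  refine ⟨hi.sub hQi, ?_⟩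
  unfold L₀adj
  rw [integral_sub hi hQi, ← integral_bind_kernel hi', ← hμ,
    integral_map hσ.aemeasurable hm.aestronglyMeasurable, sub_self]

theorem integrable_prod_minZero_sub {μ : Measure M.K} [IsFiniteMeasure μ]
    (hzb : ∃ C : ℝ, ∀ k, |M.z k| ≤ C) {a b : ℝ} (Λ : FiniteMeasure (Icc a b)) :
    Integrable (Function.uncurry fun (k : M.K) (η : Icc a b) => minZero (M.z k - (η : ℝ)))
      (μ.prod (Λ : Measure (Icc a b))) := by
  obtain ⟨C, hC⟩ := hzb
  have hm : Measurable (Function.uncurry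
      fun (k : M.K) (η : Icc a b) => minZero (M.z k - (η : ℝ))) :=
    continuous_minZero.measurable.comp
      ((M.measurable_z.comp measurable_fst).sub (measurable_subtype_coe.comp measurable_snd))
  refine integrable_of_measurable_of_abs_le hm (B := C + max |a| |b|) fun p => ?_
  have h1 : |minZero (M.z p.1 - (p.2 : ℝ))| ≤ |M.z p.1 - (p.2 : ℝ)| := by
    simpa [minZero] using abs_minZero_sub_le (M.z p.1 - (p.2 : ℝ)) 0
  exact h1.trans ((abs_sub _ _).trans
    (add_le_add (hC _) (abs_le_max_abs_abs p.2.2.1 p.2.2.2)))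

theorem integrable_integral_L₁adj {μ : Measure M.K} [IsFiniteMeasure μ]
    (hzb : ∃ C : ℝ, ∀ k, |M.z k| ≤ C) {a b : ℝ} (Λ : FiniteMeasure (Icc a b)) :
    Integrable (M.L₁adj Λ) μ ∧
      ∫ k, M.L₁adj Λ k ∂μ = ∫ η : Icc a b, M.L₁ μ η ∂(Λ : Measure (Icc a b)) := by
  obtain ⟨C, hC⟩ := hzb
  constructor
  · obtain ⟨B, hB⟩ := exists_abs_shortfallIntegral_le Λ C
    exact integrable_of_measurable_of_abs_le
      ((continuous_shortfallIntegral Λ).measurable.comp M.measurable_z) fun k => hB _ (hC k)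
  · exact integral_integral_swap (integrable_prod_minZero_sub ⟨C, hC⟩ Λ)

/-- Weak duality. -/
theorem primalObjective_le_dualObjective (hr : ∀ k, M.r k ≤ 0)
    (hzb : ∃ C : ℝ, ∀ k, |M.z k| ≤ C) {a b : ℝ} {y : ℝ → ℝ} (hy : Continuous y)
    {μ : Measure M.K} (hμ : μ ∈ M.primalFeasible a b y)
    {d : (S → ℝ) × ℝ × FiniteMeasure (Icc a b)} (hd : d ∈ M.dualFeasible a b) :
    M.primalObjective μ ≤ dualObjective y d := by
  obtain ⟨h, β, Λ⟩ := d
  obtain ⟨hh, hle⟩ := hd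
  simp only at hh hle
  have := isProbabilityMeasure_of_mem_primalFeasible hμ
  have hw := integrable_w_of_mem_primalFeasible hr hμ
  have hσ : Measurable fun k : M.K => k.1.1 := measurable_fst.comp measurable_subtype_coe
  have hri : Integrable M.r μ := by
    refine ((integrable_const (1 : ℝ)).sub hw).congr (Eventually.of_forall fun k => ?_)
    simp [w]
  have hŵ : ∀ s, 0 < M.wHat s := fun s => zero_lt_one.trans_le (one_le_wHat hr s)
  have hhi : Integrable (fun k : M.K => h k.1.1) μ := by
    refine (hw.const_mul |weightedNorm M.wHat h|).mono' (hh.1.comp hσ).aestronglyMeasurable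
      (Eventually.of_forall fun k => ?_)
    refine (abs_le_weightedNorm_mul hŵ hh k.1.1).trans ?_
    exact mul_le_mul (le_abs_self _) (wHat_le_w hr k) (hŵ _).le (abs_nonneg _)
  obtain ⟨h0i, h0⟩ := integral_L₀adj_eq_zero (map_eq_bind_of_forall_L₀ hμ.2.1) hh.1 hhi
  obtain ⟨h1i, h1⟩ := integrable_integral_L₁adj (μ := μ) hzb Λ
  have hyi : Integrable (fun η : Icc a b => y η) (Λ : Measure (Icc a b)) :=
    Continuous.integrable_of_isFiniteMeasure (hy.comp continuous_subtype_val)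
  have hL₁i : Integrable (fun η : Icc a b => M.L₁ μ η) (Λ : Measure (Icc a b)) :=
    (integrable_prod_minZero_sub hzb Λ).integral_prod_right
  have hΛ : ∫ η : Icc a b, y η ∂(Λ : Measure (Icc a b)) ≤
      ∫ η : Icc a b, M.L₁ μ η ∂(Λ : Measure (Icc a b)) :=
    integral_mono hyi hL₁i fun η => hμ.2.2.2 η η.2
  -- Integrated against `μ`, the dual constraint loses its `h` term by invariance, and Fubini turns
  -- the `Λ` term into `⟨Λ, L₁ μ⟩ ≥ ⟨Λ, y⟩`.
  have hint : ∫ k, (M.r k + M.L₀adj h k - β + M.L₁adj Λ k) ∂μ ≤ 0 := integral_nonpos hle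
  have e1 := integral_add ((hri.add h0i).sub (integrable_const β)) h1i
  have e2 := integral_sub (hri.add h0i) (integrable_const (μ := μ) β)
  have e3 := integral_add hri h0i
  simp only [Pi.add_apply, Pi.sub_apply, integral_const, probReal_univ, one_smul] at e1 e2 e3
  rw [e1, e2, e3, h0, h1] at hint
  change ∫ k, M.r k ∂μ ≤ β - ∫ η : Icc a b, y η ∂(Λ : Measure (Icc a b))
  linarith

/-- The limit of a bounded sequence of dual feasible triples along a subsequence. -/
theorem exists_dualFeasible_tendsto (hr : ∀ k, M.r k ≤ 0) (hwQ : ∀ k, Integrable M.wHat (M.Q k))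
    {a b : ℝ} (hab : a ≤ b) {y : ℝ → ℝ} (hy : Continuous y) {h : ℕ → S → ℝ} {β : ℕ → ℝ}
    {Λ : ℕ → FiniteMeasure (Icc a b)} (hfeas : ∀ n, (h n, β n, Λ n) ∈ M.dualFeasible a b)
    {Cβ Ch CΛ : ℝ} (hβ : ∀ n, |β n| ≤ Cβ) (hh : ∀ n, weightedNorm M.wHat (h n) ≤ Ch)
    (hΛ : ∀ n, ((Λ n).mass : ℝ) ≤ CΛ) :
    ∃ d ∈ M.dualFeasible a b, ∃ φ : ℕ → ℕ, StrictMono φ ∧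
      Tendsto (fun n => dualObjective y (h (φ n), β (φ n), Λ (φ n))) atTop
        (𝓝 (dualObjective y d)) := by
  have : Nonempty (Icc a b) := ⟨⟨a, le_rfl, hab⟩⟩
  have hŵ : ∀ s, 0 < M.wHat s := fun s => zero_lt_one.trans_le (one_le_wHat hr s)
  obtain ⟨Λ', β', φ, hφ, hβ', hΛ'⟩ := exists_subseq_tendsto_integral Λ hΛ β hβ
  obtain ⟨h', hm, hC, hle⟩ := exists_measurable_limit_le_integral M.Q (fun k : M.K => k.1.1)
    (W := fun s => Ch * M.wHat s) (fun k => (hwQ k).const_mul Ch) (h := fun n => h (φ n))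
    (fun n => (hfeas _).1.1) (fun n s => (abs_le_weightedNorm_mul hŵ (hfeas (φ n)).1 s).trans
      (mul_le_mul_of_nonneg_right (hh _) (hŵ s).le))
    (c := fun n k => β (φ n) - M.r k - M.L₁adj (Λ (φ n)) k)
    (c' := fun k => β' - M.r k - M.L₁adj Λ' k)
    (fun k => (hβ'.sub_const _).sub (hΛ' (fun η => minZero (M.z k - (η : ℝ)))
      (continuous_minZero.comp (continuous_const.sub continuous_subtype_val))))
    (fun n k => by
      have := (hfeas (φ n)).2 k
      simp only [L₀adj] at this
      linarith)
  refine ⟨(h', β', Λ'), ⟨mem_weightedFunctions_of_abs_le hŵ hm hC, fun k => ?_⟩, φ, hφ, ?_⟩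
  · have := hle k
    simp only [L₀adj]
    linarith
  · exact hβ'.sub (hΛ' (fun η : Icc a b => y η) (hy.comp continuous_subtype_val))

/-! ### The cone of dual test functions. -/

/-- The functions `L₀* h + L₁* Λ - ⟨Λ, y⟩` with `h` bounded and continuous. -/
def dualCone (M : MDP S A) (a b : ℝ) (y : ℝ → ℝ) : Set (M.K → ℝ) :=
  {f | ∃ (h : BoundedContinuousFunction S ℝ) (Λ : FiniteMeasure (Icc a b)),
    f = fun k => M.L₀adj h k + M.L₁adj Λ k - ∫ η : Icc a b, y η ∂(Λ : Measure (Icc a b))}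

variable {a b : ℝ} {y : ℝ → ℝ}

theorem add_mem_dualCone [BorelSpace S] (hy : Continuous y) {f g : M.K → ℝ} (hf : f ∈ M.dualCone a b y)
    (hg : g ∈ M.dualCone a b y) : f + g ∈ M.dualCone a b y := by
  obtain ⟨h, Λ, rfl⟩ := hf
  obtain ⟨h', Λ', rfl⟩ := hg
  have hyi : ∀ Λ : FiniteMeasure (Icc a b),
      Integrable (fun η : Icc a b => y η) (Λ : Measure (Icc a b)) := fun Λ =>
    Continuous.integrable_of_isFiniteMeasure (hy.comp continuous_subtype_val)
  refine ⟨h + h', Λ + Λ', funext fun k => ?_⟩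
  simp only [Pi.add_apply, L₀adj, L₁adj, FiniteMeasure.toMeasure_add,
    BoundedContinuousFunction.coe_add]
  rw [integral_add_measure (hyi Λ) (hyi Λ'),
    integral_add_measure (integrable_minZero_sub Λ _) (integrable_minZero_sub Λ' _),
    integral_add (h.integrable _) (h'.integrable _)]
  ring

theorem smul_mem_dualCone {f : M.K → ℝ} (hf : f ∈ M.dualCone a b y) {c : ℝ} (hc : 0 ≤ c) :
    c • f ∈ M.dualCone a b y := by
  obtain ⟨h, Λ, rfl⟩ := hf
  lift c to NNReal using hc
  refine ⟨(c : ℝ) • h, c • Λ, funext fun k => ?_⟩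
  simp only [Pi.smul_apply, L₀adj, L₁adj, FiniteMeasure.toMeasure_smul, smul_eq_mul,
    BoundedContinuousFunction.coe_smul, integral_const_mul, integral_smul_nnreal_measure]
  simp only [NNReal.smul_def, smul_eq_mul]
  ring

/-- The `h` part is continuous by weak continuity of `Q`. The `Λ` part is a continuous function of
`z` that is also increasing, which is what preserves upper semicontinuity. -/
theorem upperSemicontinuous_of_mem_dualCone (hz : UpperSemicontinuous M.z)
    (hQ : ∀ f : BoundedContinuousFunction S ℝ, Continuous fun k : M.K => ∫ ξ, f ξ ∂(M.Q k))
    {f : M.K → ℝ} (hf : f ∈ M.dualCone a b y) : UpperSemicontinuous f := by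
  obtain ⟨h, Λ, rfl⟩ := hf
  have h1 : Continuous (M.L₀adj h) :=
    (h.continuous.comp (continuous_fst.comp continuous_subtype_val)).sub (hQ h)
  have h2 : UpperSemicontinuous (M.L₁adj Λ) :=
    (continuous_shortfallIntegral Λ).comp_upperSemicontinuous hz (monotone_shortfallIntegral Λ)
  simp only [sub_eq_add_neg]
  exact (h1.upperSemicontinuous.add h2).add continuous_const.upperSemicontinuous

theorem abs_L₀adj_le (h : BoundedContinuousFunction S ℝ) (k : M.K) :
    |M.L₀adj h k| ≤ ‖h‖ + ‖h‖ := by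
  refine (abs_sub _ _).trans (add_le_add (h.norm_coe_le_norm _) ?_)
  simpa using norm_integral_le_of_norm_le_const (μ := M.Q k)
    (Eventually.of_forall h.norm_coe_le_norm)

theorem exists_abs_le_of_mem_dualCone (hzb : ∃ C : ℝ, ∀ k, |M.z k| ≤ C)
    {f : M.K → ℝ} (hf : f ∈ M.dualCone a b y) : ∃ B : ℝ, ∀ k, |f k| ≤ B := by
  obtain ⟨h, Λ, rfl⟩ := hf
  obtain ⟨C, hC⟩ := hzb
  obtain ⟨B, hB⟩ := exists_abs_shortfallIntegral_le Λ C
  refine ⟨‖h‖ + ‖h‖ + B + |∫ η : Icc a b, y η ∂(Λ : Measure (Icc a b))|, fun k => ?_⟩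
  exact (abs_sub _ _).trans (add_le_add ((abs_add_le _ _).trans
    (add_le_add (abs_L₀adj_le h k) (hB _ (hC k)))) le_rfl)

end Duality

/-! ### Construction of a primal optimal measure. -/

section Primal

variable {S A : Type*}
  [TopologicalSpace S] [TopologicalSpace.MetrizableSpace S] [SecondCountableTopology S]
  [MeasurableSpace S] [BorelSpace S]
  [TopologicalSpace A] [TopologicalSpace.MetrizableSpace A] [SecondCountableTopology A]
  [MeasurableSpace A] [BorelSpace A]

variable {M : MDP S A} {a b : ℝ} {y : ℝ → ℝ}

/-- A lower bound for the dual problem is attained by a primal feasible measure. -/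
theorem exists_primalFeasible_le (hr : ∀ k, M.r k ≤ 0)
    (hrK : ∀ ε : ℝ, 0 ≤ ε → IsCompact {k : M.K | -ε ≤ M.r k})
    (hzb : ∃ C : ℝ, ∀ k, |M.z k| ≤ C) (hz : UpperSemicontinuous M.z)
    (hQ : ∀ f : BoundedContinuousFunction S ℝ, Continuous fun k : M.K => ∫ ξ, f ξ ∂(M.Q k))
    (hy : Continuous y) {v : ℝ} (hv : ∀ d ∈ M.dualFeasible a b, v ≤ dualObjective y d) :
    ∃ μ ∈ M.primalFeasible a b y, v ≤ M.primalObjective μ := by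
  have hzero : (0 : M.K → ℝ) ∈ M.dualCone a b y :=
    ⟨0, 0, funext fun k => by simp [L₀adj, L₁adj]⟩
  have hŵ : ∀ s, 0 < M.wHat s := fun s => zero_lt_one.trans_le (one_le_wHat hr s)
  obtain ⟨μ, hi, hle, hF⟩ := exists_probabilityMeasure_of_forall_cone (ℓ := fun k => -M.r k)
    (fun k => neg_nonneg.2 (hr k)) (fun c hc => by simpa only [neg_le] using hrK c hc) hzero
    (fun f hf g hg => add_mem_dualCone hy hf hg) (fun f hf c hc => smul_mem_dualCone hf hc)
    (fun f hf => upperSemicontinuous_of_mem_dualCone hz hQ hf)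
    (fun f hf => exists_abs_le_of_mem_dualCone hzb hf) (v := v) (by
      rintro _ ⟨h, Λ, rfl⟩ ε hε
      by_contra! hcon
      -- `β` is chosen to make the dual objective equal to `v - ε`; the negated claim is then
      -- exactly the dual constraint.
      have hd : (⇑h, v - ε + ∫ η : Icc a b, y η ∂(Λ : Measure (Icc a b)), Λ) ∈
          M.dualFeasible a b := by
        refine ⟨mem_weightedFunctions_of_abs_le hŵ h.continuous.measurable (C := ‖h‖) fun s =>
          (h.norm_coe_le_norm s).trans ?_, fun k => ?_⟩
        · exact le_mul_of_one_le_right (norm_nonneg _) (one_le_wHat hr s)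
        · have := hcon k
          simp only
          linarith
      have := hv _ hd
      simp only [dualObjective] at this
      linarith)
  have hri : Integrable M.r (μ : Measure M.K) := by simpa using hi.neg
  have hσ : Measurable fun k : M.K => k.1.1 := measurable_fst.comp measurable_subtype_coe
  have hL₀i : ∀ h : BoundedContinuousFunction S ℝ, Integrable (M.L₀adj h) (μ : Measure M.K) :=
    fun h => integrable_of_measurable_of_abs_le
      ((h.continuous.comp (continuous_fst.comp continuous_subtype_val)).sub (hQ h)).measurable
      (abs_L₀adj_le h)
  have hL₀ : ∀ h : BoundedContinuousFunction S ℝ, ∫ k, M.L₀adj h k ∂(μ : Measure M.K) = 0 := by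
    -- With `Λ = 0` the cone contains both `L₀* h` and `L₀* (-h)`, so the inequality becomes an
    -- equality.
    have hnn : ∀ h : BoundedContinuousFunction S ℝ,
        0 ≤ ∫ k, M.L₀adj h k ∂(μ : Measure M.K) := fun h => by
      simpa [L₁adj] using hF _ ⟨h, 0, rfl⟩
    intro h
    refine le_antisymm ?_ (hnn h)
    have h1 := hnn (-h)
    have e : ∀ k, M.L₀adj (-h : BoundedContinuousFunction S ℝ) k = -M.L₀adj h k := fun k => by
      simp only [L₀adj, BoundedContinuousFunction.coe_neg, Pi.neg_apply, integral_neg]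
      ring
    simp only [e, integral_neg] at h1
    linarith
  have hinv : (μ : Measure M.K).map (fun k : M.K => k.1.1) = (μ : Measure M.K).bind M.Q := by
    have : IsFiniteMeasure ((μ : Measure M.K).map (fun k : M.K => k.1.1)) :=
      Measure.isFiniteMeasure_map _ _
    refine ext_of_forall_integral_eq_of_IsFiniteMeasure fun h => ?_
    have hhi : Integrable (fun k : M.K => h k.1.1) (μ : Measure M.K) :=
      integrable_of_measurable_of_abs_le (h.continuous.measurable.comp hσ)
        fun k => h.norm_coe_le_norm _
    have h1 := hL₀ h
    have hQi : Integrable (fun k => ∫ ξ, h ξ ∂(M.Q k)) (μ : Measure M.K) := by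
      refine (hhi.sub (hL₀i h)).congr (Eventually.of_forall fun k => ?_)
      simp [L₀adj]
    simp only [L₀adj] at h1
    rw [integral_sub hhi hQi] at h1
    rw [integral_map hσ.aemeasurable h.continuous.measurable.aestronglyMeasurable,
      integral_bind_kernel (h.integrable _)]
    linarith
  refine ⟨μ, ⟨?_, fun B hB => L₀_eq_zero_of_map_eq_bind hinv hB, by simp, fun η hη => ?_⟩, ?_⟩
  · have hwi : Integrable M.w (μ : Measure M.K) := (integrable_const 1).sub hri
    have h2 := hwi.2
    rwa [hasFiniteIntegral_iff_ofReal
      (Eventually.of_forall fun k => zero_le_one.trans (one_le_w hr k))] at h2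
  · let Λ : FiniteMeasure (Icc a b) := ⟨Measure.dirac ⟨η, hη⟩, inferInstance⟩
    have h1 := hF _ ⟨0, Λ, rfl⟩
    have h2 := (integrable_integral_L₁adj (μ := (μ : Measure M.K)) hzb Λ)
    have e : ∀ k, M.L₀adj (0 : BoundedContinuousFunction S ℝ) k = 0 := fun k => by simp [L₀adj]
    simp only [e, zero_add] at h1
    rw [integral_sub h2.1 (integrable_const _), h2.2] at h1
    simpa [Λ] using h1
  · simpa [integral_neg, primalObjective] using hle

end Primal

end MDP

end

/-! ### Strong duality. -/

theorem mainTheorem3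
    {S A Ω : Type*}
    [TopologicalSpace S] [TopologicalSpace.MetrizableSpace S] [SecondCountableTopology S]
    [MeasurableSpace S] [BorelSpace S]
    [TopologicalSpace A] [TopologicalSpace.MetrizableSpace A] [SecondCountableTopology A]
    [MeasurableSpace A] [BorelSpace A]
    [MeasurableSpace Ω] (P : Measure Ω) [IsProbabilityMeasure P]
    (M : MDP S A) (a b : ℝ) (Y : Ω → ℝ)
    (hY : Measurable Y) (hYab : ∀ᵐ ω ∂P, Y ω ∈ Icc a b)
    -- the stochastic dominance-constrained problem is consistent
    (hΔ : (M.dominanceFeasible a b (benchmarkShortfall P Y)).Nonempty)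
    -- `r` is nonpositive with compact superlevel sets
    (hr : ∀ k, M.r k ≤ 0)
    (hrK : ∀ ε : ℝ, 0 ≤ ε → IsCompact {k : M.K | -ε ≤ M.r k})
    -- `z` is bounded and upper semicontinuous
    (hzb : ∃ C : ℝ, ∀ k, |M.z k| ≤ C) (hz : UpperSemicontinuous M.z)
    -- `Q` is weakly continuous
    (hQ : ∀ f : BoundedContinuousFunction S ℝ, Continuous fun k : M.K => ∫ ξ, f ξ ∂(M.Q k))
    -- `(z - η)₋` and `(s, a) ↦ ∫ ŵ(ξ) Q(dξ | s, a)` belong to `F_w(K)`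
    (hzw : ∀ η ∈ Icc a b, (fun k => minZero (M.z k - η)) ∈ weightedFunctions M.w)
    (hwQ : ∀ k, Integrable M.wHat (M.Q k))
    (hwQw : (fun k => ∫ ξ, M.wHat ξ ∂(M.Q k)) ∈ weightedFunctions M.w)
    -- there is a bounded minimizing sequence `(h n, β n, Λ n)` of the dual problem
    (hmin : ∃ (h : ℕ → S → ℝ) (β : ℕ → ℝ) (Λ : ℕ → FiniteMeasure (Icc a b)),
      (∀ n, (h n, β n, Λ n) ∈ M.dualFeasible a b) ∧
      Tendsto (fun n => (MDP.dualObjective (benchmarkShortfall P Y) (h n, β n, Λ n) : EReal))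
        atTop (𝓝 (M.dualValue a b (benchmarkShortfall P Y))) ∧
      (∃ C : ℝ, ∀ n, |β n| ≤ C) ∧
      (∃ C : ℝ, ∀ n, weightedNorm M.wHat (h n) ≤ C) ∧
      (∀ f : C(Icc a b, ℝ), ∃ C : ℝ, ∀ n, |∫ η, f η ∂(Λ n : Measure (Icc a b))| ≤ C)) :
    M.primalValue a b (benchmarkShortfall P Y) = M.dualValue a b (benchmarkShortfall P Y) ∧
    (∃ μ ∈ M.primalFeasible a b (benchmarkShortfall P Y),
      (M.primalObjective μ : EReal) = M.primalValue a b (benchmarkShortfall P Y)) ∧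
    (∃ d ∈ M.dualFeasible a b,
      (MDP.dualObjective (benchmarkShortfall P Y) d : EReal) =
        M.dualValue a b (benchmarkShortfall P Y)) := by
  obtain ⟨h, β, Λ, hfeas, hlim, ⟨Cβ, hβ⟩, ⟨Ch, hh⟩, hΛ⟩ := hmin
  obtain ⟨ω, hω⟩ := hYab.exists
  have hab : a ≤ b := hω.1.trans hω.2
  have hy : Continuous (benchmarkShortfall P Y) := continuous_benchmarkShortfall hY hYab
  -- The constant test function turns weak* boundedness into a bound on the masses.
  obtain ⟨CΛ, hCΛ⟩ := hΛ 1
  have hmass : ∀ n, ((Λ n).mass : ℝ) ≤ CΛ := fun n => by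
    have h1 := (le_abs_self _).trans (hCΛ n)
    simp only [ContinuousMap.one_apply, integral_const, smul_eq_mul, mul_one] at h1
    exact h1
  obtain ⟨d, hd, φ, hφ, hdlim⟩ :=
    MDP.exists_dualFeasible_tendsto hr hwQ hab hy hfeas hβ hh hmass
  have hval : (MDP.dualObjective (benchmarkShortfall P Y) d : EReal) =
      M.dualValue a b (benchmarkShortfall P Y) :=
    -- The objectives along the subsequence converge both to that of `d` and to the dual value,
    -- which is therefore a real number.
    tendsto_nhds_unique ((continuous_coe_real_ereal.tendsto _).comp hdlim)
      (hlim.comp hφ.tendsto_atTop)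
  have hle : ∀ d' ∈ M.dualFeasible a b, MDP.dualObjective (benchmarkShortfall P Y) d ≤
      MDP.dualObjective (benchmarkShortfall P Y) d' := fun d' hd' => by
    rw [← EReal.coe_le_coe_iff, hval]
    exact iInf₂_le d' hd'
  obtain ⟨μ, hμ, hμle⟩ := MDP.exists_primalFeasible_le hr hrK hzb hz hQ hy hle
  have hweak : ∀ μ' ∈ M.primalFeasible a b (benchmarkShortfall P Y),
      M.primalObjective μ' ≤ MDP.dualObjective (benchmarkShortfall P Y) d := fun μ' hμ' =>
    MDP.primalObjective_le_dualObjective hr hzb hy hμ' hd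
  have hprimal : M.primalValue a b (benchmarkShortfall P Y) =
      (MDP.dualObjective (benchmarkShortfall P Y) d : EReal) := by
    refine le_antisymm (iSup₂_le fun μ' hμ' => EReal.coe_le_coe_iff.2 (hweak μ' hμ')) ?_
    exact (EReal.coe_le_coe_iff.2 hμle).trans
      (le_iSup₂ (f := fun μ' (_ : μ' ∈ M.primalFeasible a b (benchmarkShortfall P Y)) =>
        (M.primalObjective μ' : EReal)) μ hμ)
  refine ⟨hprimal.trans hval, ⟨μ, hμ, ?_⟩, d, hd, hval⟩
  rw [hprimal, le_antisymm (hweak μ hμ) hμle]
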